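/- Let $$G_4=\langle a,b,c,d,s \mid [a,b]c^{-1},\ [a,c],\ [b,c],\ [b,d],\ (asa^{-1})s^{-2},\ (dsd^{-1})s^{-2}\rangle,\qquad [x,y]=xyx^{-1}y^{-1}.$$ An annular diagram over a finite presentation $\langle X\mid R\rangle$ for a pair of words $u,v$ is a finite cell decomposition of the 2-sphere with the interiors of two faces removed, with edges directed and labelled by elements of $X$, such that $u$ and $v$ are read (from some starting vertices, in the same direction around the annulus) along the two boundary components and a word of $R^{\pm1}$ is read around every remaining face. In the degenerate case where $u$ or $v$ is the empty word, the diagram is a van Kampen diagram for the other word (the corresponding boundary component is a vertex). $\mathrm{Ann}(u,v)$ is the minimal number of faces of an annular diagram for $u,v$, and the annular Dehn function $\mathrm{Ann}(n)$ is the maximum of $\mathrm{Ann}(u,v)$ over all words $u,v$ that represent conjugate elements of the group and satisfy $|u|+|v|\le n$. Write $f\preceq g$ if there is a constant $C>0$ with $f(n)\le C\,g(Cn+n)+Cn+C$ for all $n\in\mathbb N$. Then, for the above presentation of $G_4$, $$2^{n^2}\ \preceq\ \mathrm{Ann}_{G_4}(n).$$ Moreover, for every $n\ge 1$, the words $u=b^{-1}c^{n^2}s$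 and $v=b^{-1}s$ represent conjugate elements of $G_4$, and every annular diagram for $u$ and $v$ has at least $2^{n^2-1}$ faces, i.e. $\mathrm{Ann}(u,v)\ge 2^{n^2-1}$. -/

import Mathlib

/-! ### Words, presentations and the relation `≼` -/

/-- Words on `X` and formal inverses: `(x, true)` is the letter `x`, `(x, false)` is `x⁻¹`. -/
abbrev GWord (X : Type) : Type := List (X × Bool)

/-- The group `⟨X ∣ R⟩`. -/
abbrev GroupOf {X : Type} (R : Set (GWord X)) : Type :=
  PresentedGroup (FreeGroup.mk '' R)

/-- The element of `⟨X ∣ R⟩` represented by a word. -/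
def evalWord {X : Type} (R : Set (GWord X)) (w : GWord X) : GroupOf R :=
  PresentedGroup.mk (FreeGroup.mk '' R) (FreeGroup.mk w)

/-- The words `u` and `v` represent conjugate elements of `⟨X ∣ R⟩`. -/
def ConjWords {X : Type} (R : Set (GWord X)) (u v : GWord X) : Prop :=
  IsConj (evalWord R u) (evalWord R v)

/-- `f ≼ g`: there is `C > 0` with `f n ≤ C g(Cn + n) + Cn + C` for all `n`. -/
def AsympLE (f g : ℕ → ℕ∞) : Prop :=
  ∃ C : ℕ, 0 < C ∧ ∀ n : ℕ, f n ≤ C * g (C * n + n) + C * n + C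

/-! ### Diagrams -/

/-- A finite cell decomposition of the (oriented) 2-sphere with at least one edge, whose directed
edges are labelled by letters, given as a combinatorial map.

A dart is a directed edge. `rev` reverses a dart, and `next` sends a dart to the following one in
the boundary walk of the face on its left. So the edges are the cycles of `rev`, the faces are
the cycles of `next`, and the vertices are the cycles of `x ↦ next (rev x)`, which turns a dart
around its initial vertex. The surface obtained by gluing the faces along the edges is
a sphere if and only if it is connected and `V - E + F = 2`. -/
structure LabelledSphere (X : Type) where
  Dart : Type
  finite : Finite Dart
  nonempty : Nonempty Dart
  rev : Equiv.Perm Dart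
  rev_rev : ∀ x, rev (rev x) = x
  rev_ne : ∀ x, rev x ≠ x
  next : Equiv.Perm Dart
  connected : ∀ x y, ∃ g ∈ Subgroup.closure {rev, next}, g x = y
  euler : Nat.card (Quotient (Equiv.Perm.SameCycle.setoid (next * rev))) +
      Nat.card (Quotient (Equiv.Perm.SameCycle.setoid next)) =
    Nat.card (Quotient (Equiv.Perm.SameCycle.setoid rev)) + 2
  label : Dart → X × Bool
  label_rev : ∀ x, label (rev x) = ((label x).1, !(label x).2)

namespace LabelledSphere

variable {X : Type}

/-- The faces of the cell decomposition. -/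
def Face (S : LabelledSphere X) : Type := Quotient (Equiv.Perm.SameCycle.setoid S.next)

/-- The face to the left of a dart. -/
def faceOf (S : LabelledSphere X) (x : S.Dart) : S.Face :=
  Quotient.mk (Equiv.Perm.SameCycle.setoid S.next) x

/-- The word read once around the face to the left of `x`, starting with `x`. -/
noncomputable def wordFrom (S : LabelledSphere X) (x : S.Dart) : GWord X :=
  (List.range (Function.minimalPeriod S.next x)).map fun k => S.label ((S.next ^ k) x)

/-- `w` is read around the face `f`, from some starting vertex. -/
def Reads (S : LabelledSphere X) (f : S.Face) (w : GWord X) : Prop :=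
  ∃ x, S.faceOf x = f ∧ S.wordFrom x = w

/-- The word read around `f`, from some starting vertex and in some direction, is in `R`. -/
def IsCell (S : LabelledSphere X) (R : Set (GWord X)) (f : S.Face) : Prop :=
  ∃ r ∈ R, S.Reads f r ∨ S.Reads f (FreeGroup.invRev r)

end LabelledSphere

/-- A van Kampen diagram with at least one edge, for the word `w`: a sphere
from which one face (the face at infinity), around which `w` is read, is removed. -/
structure DiscDiagram {X : Type} (R : Set (GWord X)) (w : GWord X) where
  sphere : LabelledSphere X
  outer : sphere.Face
  reads_outer : sphere.Reads outer w
  cell : ∀ f, f ≠ outer → sphere.IsCell R f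

/-- A non-degenerate annular diagram for the words `u` and `v`: a sphere from which two
faces are removed. As all faces are traversed with the face on the left, the two boundary
components are traversed in the same direction around the annulus when `u` is read around one
removed face and `v⁻¹` around the other. -/
structure AnnulusDiagram {X : Type} (R : Set (GWord X)) (u v : GWord X) where
  sphere : LabelledSphere X
  outer : sphere.Face
  inner : sphere.Face
  outer_ne_inner : outer ≠ inner
  reads_outer : sphere.Reads outer u
  reads_inner : sphere.Reads inner (FreeGroup.invRev v)
  cell : ∀ f, f ≠ outer → f ≠ inner → sphere.IsCell R f

/-- Annular diagrams over `⟨X ∣ R⟩` for a pair of words, including the degenerate ones, where one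
boundary component is just a vertex of a van Kampen diagram (which may itself be one point). -/
inductive AnnularDiagram {X : Type} (R : Set (GWord X)) : GWord X → GWord X → Type 1
  | point : AnnularDiagram R [] []
  | discLeft {u : GWord X} (D : DiscDiagram R u) : AnnularDiagram R u []
  | discRight {v : GWord X} (D : DiscDiagram R v) : AnnularDiagram R [] v
  | annulus {u v : GWord X} (D : AnnulusDiagram R u v) : AnnularDiagram R u v

/-- The area of an annular diagram: the number of its faces (removed faces do not count). -/
noncomputable def AnnularDiagram.area {X : Type} {R : Set (GWord X)} {u v : GWord X} :
    AnnularDiagram R u v → ℕ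
  | .point => 0
  | .discLeft D => Nat.card {f : D.sphere.Face // f ≠ D.outer}
  | .discRight D => Nat.card {f : D.sphere.Face // f ≠ D.outer}
  | .annulus D => Nat.card {f : D.sphere.Face // f ≠ D.outer ∧ f ≠ D.inner}

/-- `Ann(u, v)`: the minimal area of an annular diagram for `u` and `v`. -/
noncomputable def annArea {X : Type} (R : Set (GWord X)) (u v : GWord X) : ℕ∞ :=
  ⨅ D : AnnularDiagram R u v, (D.area : ℕ∞)

/-- The annular Dehn function of the presentation `⟨X ∣ R⟩`: the maximum of `Ann(u, v)` over all
`u`, `v` that represent conjugate elements and have `|u| + |v| ≤ n`. -/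
noncomputable def annularDehn {X : Type} (R : Set (GWord X)) (n : ℕ) : ℕ∞ :=
  ⨆ (u : GWord X) (v : GWord X) (_ : u.length + v.length ≤ n) (_ : ConjWords R u v),
    annArea R u v

/-! ### The group `G₄` -/

/-- The generators of `G₄`. -/
inductive GenG4 : Type
  | a | b | c | d | s

namespace GenG4

/-- The letter `x`. -/
def pos (x : GenG4) : GWord GenG4 := [(x, true)]

/-- The letter `x⁻¹`. -/
def neg (x : GenG4) : GWord GenG4 := [(x, false)]

/-- The defining relators
`[a,b]c⁻¹, [a,c], [b,c], [b,d], (a s a⁻¹)s⁻², (d s d⁻¹)s⁻²`, where `[x,y] = x y x⁻¹ y⁻¹`. -/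
def relators : Set (GWord GenG4) :=
  { a.pos ++ b.pos ++ a.neg ++ b.neg ++ c.neg,
    a.pos ++ c.pos ++ a.neg ++ c.neg,
    b.pos ++ c.pos ++ b.neg ++ c.neg,
    b.pos ++ d.pos ++ b.neg ++ d.neg,
    a.pos ++ s.pos ++ a.neg ++ s.neg ++ s.neg,
    d.pos ++ s.pos ++ d.neg ++ s.neg ++ s.neg }

/-- The word `b⁻¹ c^(n²) s`. -/
def witnessU (n : ℕ) : GWord GenG4 :=
  b.neg ++ List.replicate (n ^ 2) (c, true) ++ s.pos

/-- The word `b⁻¹ s`. -/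
def witnessV : GWord GenG4 := b.neg ++ s.pos

end GenG4

/-! The lower bound is a weight argument on an action graph. The group acts on ℤ × ℚ by `perm` with
`s` acting trivially, so every `s`-edge is a loop; the loop at (m, y) has weight 2^(m-1) if m ≥ 1
and 0 otherwise. Since `a` and `d` double this weight up to an error of 1, every relator has total
weight at most 1 in absolute value (`abs_walkWeight_relator_le`). With k = n², the word b⁻¹c^k s
closes up at (k, 0) with weight 2^(k-1), whereas b⁻¹s closes up only on the line x = 0, where the
weight vanishes.

An annular diagram maps to the action graph once one boundary word closes up (`exists_compatible`):
modulo the cells, that boundary carries all loops of the annulus. Combinatorially this rests on a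
tree-cotree decomposition (`exists_tree_cotree`). The two darts of an edge have opposite weights, so
the face weights sum to 0. The outer face gives 2^(k-1), the inner one 0, and each cell at least -1;
hence there are at least 2^(k-1) cells (`le_annArea`).

The words are conjugate because a^k and d^k conjugate them to the same element b⁻¹s^(2^k)
(`isConj_of_doubling`). For the Dehn function, c^(n²) is rewritten as [aⁿ, bⁿ], which makes the
length linear in n. -/

/-! ### Rooted spanning trees of graphs given by darts -/

/-- A rooted spanning tree of the graph whose darts are reversed by `rev` and start at `τ`:
every vertex other than the root has a dart leading to its parent. -/
structure DartTree {D V : Type} (rev : Equiv.Perm D) (τ : D → V) (r : V) where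
  depth : V → ℕ
  par : V → D
  tail_par : ∀ v, v ≠ r → τ (par v) = v
  depth_lt : ∀ v, v ≠ r → depth (τ (rev (par v))) < depth v

namespace DartTree

variable {D V : Type} {rev : Equiv.Perm D} {τ : D → V} {r : V}

/-- The darts of the tree, in both directions. -/
def darts (T : DartTree rev τ r) : Set D :=
  {x | ∃ v, v ≠ r ∧ (x = T.par v ∨ x = rev (T.par v))}

/-- A graph in which every set of vertices that contains the root and is closed under passing
along the darts in `P` contains all vertices has a spanning tree with darts in `P`. -/
theorem exists_subset [Nonempty D] (hrev : ∀ x, rev (rev x) = x) (P : Set D)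
    (hP : ∀ x ∈ P, rev x ∈ P)
    (hconn : ∀ A : Set V, r ∈ A → (∀ x ∈ P, τ x ∈ A → τ (rev x) ∈ A) → ∀ v, v ∈ A) :
    ∃ T : DartTree rev τ r, T.darts ⊆ P := by
  classical
  -- `level n` is the ball of radius n about the root in the graph of darts in `P`; the depth is the
  -- distance to the root.
  let level : ℕ → Set V := fun n =>
    Nat.rec (motive := fun _ => Set V) {r}
      (fun _ A => A ∪ {v | ∃ x ∈ P, τ x ∈ A ∧ τ (rev x) = v}) n
  have hreach : ∀ v, ∃ n, v ∈ level n := by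
    refine hconn {v | ∃ n, v ∈ level n} ⟨0, rfl⟩ ?_
    rintro x hx ⟨n, hn⟩
    exact ⟨n + 1, Or.inr ⟨x, hx, hn, rfl⟩⟩
  let depth : V → ℕ := fun v => Nat.find (hreach v)
  have hpar : ∀ v, ∃ x, v ≠ r → x ∈ P ∧ τ x = v ∧ depth (τ (rev x)) < depth v := by
    intro v
    by_cases hv : v = r
    -- The root has no parent; its value is arbitrary.
    · exact ⟨Classical.arbitrary D, fun h => absurd hv h⟩
    have hmem : v ∈ level (depth v) := Nat.find_spec (hreach v)
    obtain hd | ⟨m, hm⟩ : depth v = 0 ∨ ∃ m, depth v = m + 1 := by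
      cases h : depth v
      · exact Or.inl rfl
      · exact Or.inr ⟨_, rfl⟩
    · rw [hd] at hmem
      exact absurd hmem hv
    · rw [hm] at hmem
      rcases hmem with h | ⟨x, hx, hxm, hxv⟩
      · have : depth v ≤ m := Nat.find_min' (hreach v) h
        omega
      · refine ⟨rev x, fun _ => ⟨hP x hx, hxv, ?_⟩⟩
        rw [hrev]
        have : depth (τ x) ≤ m := Nat.find_min' (hreach (τ x)) hxm
        omega
  choose par hpar using hpar
  refine ⟨⟨depth, par, fun v hv => (hpar v hv).2.1, fun v hv => (hpar v hv).2.2⟩, ?_⟩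
  rintro x ⟨v, hv, rfl | rfl⟩
  · exact (hpar v hv).1
  · exact hP _ (hpar v hv).1

theorem par_injOn (T : DartTree rev τ r) : Set.InjOn T.par {v | v ≠ r} := by
  intro v hv w hw h
  rw [← T.tail_par v hv, ← T.tail_par w hw, h]

/-- Otherwise v and w would be parents of each other, and each would be deeper than the other. -/
theorem par_ne_rev_par (T : DartTree rev τ r) (hrev : ∀ x, rev (rev x) = x) {v w : V}
    (hv : v ≠ r) (hw : w ≠ r) : T.par v ≠ rev (T.par w) := by
  intro h
  have h1 := T.depth_lt w hw
  rw [← h, T.tail_par v hv] at h1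
  have h2 := T.depth_lt v hv
  rw [h, hrev, T.tail_par w hw] at h2
  omega

/-- A tree with `n` vertices has `2 (n - 1)` darts. -/
theorem card_darts [Finite D] [Finite V] (T : DartTree rev τ r)
    (hrev : ∀ x, rev (rev x) = x) : T.darts.ncard + 2 = 2 * Nat.card V := by
  have hunion : T.darts = T.par '' {v | v ≠ r} ∪ rev '' (T.par '' {v | v ≠ r}) := by
    ext x
    constructor
    · rintro ⟨v, hv, rfl | rfl⟩
      · exact Or.inl ⟨v, hv, rfl⟩
      · exact Or.inr ⟨_, ⟨v, hv, rfl⟩, rfl⟩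
    · rintro (⟨v, hv, rfl⟩ | ⟨_, ⟨v, hv, rfl⟩, rfl⟩)
      · exact ⟨v, hv, Or.inl rfl⟩
      · exact ⟨v, hv, Or.inr rfl⟩
  have hdisj : Disjoint (T.par '' {v | v ≠ r}) (rev '' (T.par '' {v | v ≠ r})) := by
    rw [Set.disjoint_left]
    rintro _ ⟨v, hv, rfl⟩ ⟨_, ⟨w, hw, rfl⟩, h⟩
    exact T.par_ne_rev_par hrev hv hw h.symm
  have hcompl : ({v | v ≠ r} : Set V).ncard + 1 = Nat.card V := by
    have h := Set.ncard_add_ncard_compl ({r} : Set V)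
    rw [Set.ncard_singleton] at h
    rw [← h, add_comm]
    rfl
  rw [hunion, Set.ncard_union_eq hdisj (Set.toFinite _) (Set.toFinite _),
    Set.ncard_image_of_injective _ rev.injective, T.par_injOn.ncard_image]
  omega

/-- A nonempty set of edges of a rooted tree has a leaf other than the root. -/
theorem exists_leaf [Finite V] (T : DartTree rev τ r) (hrev : ∀ x, rev (rev x) = x) {K : Set D}
    (hK : K ⊆ T.darts) (hKrev : ∀ x ∈ K, rev x ∈ K) (hne : K.Nonempty) :
    ∃ v, v ≠ r ∧ ∃ x ∈ K, τ x = v ∧ ∀ y ∈ K, τ y = v → y = x := by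
  have hS : ({v | v ≠ r ∧ T.par v ∈ K} : Set V).Nonempty := by
    obtain ⟨x, hx⟩ := hne
    obtain ⟨v, hv, rfl | rfl⟩ := hK hx
    · exact ⟨v, hv, hx⟩
    · exact ⟨v, hv, by simpa [hrev] using hKrev _ hx⟩
  -- Take v deepest among the vertices whose parent dart is in `K`. Any other dart of `K` at v would
  -- lead to a child, which is deeper.
  obtain ⟨v, ⟨hv, hvK⟩, hmax⟩ := Set.exists_max_image _ T.depth (Set.toFinite _) hS
  refine ⟨v, hv, T.par v, hvK, T.tail_par v hv, fun y hy hyv => ?_⟩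
  obtain ⟨w, hw, rfl | rfl⟩ := hK hy
  · rw [T.tail_par w hw] at hyv
    rw [hyv]
  · have h1 := hmax w ⟨hw, by simpa [hrev] using hKrev _ hy⟩
    have h2 := T.depth_lt w hw
    rw [hyv] at h2
    omega

/-- Functions on the vertices of a rooted tree can be defined by recursion from the root. -/
theorem exists_rec (T : DartTree rev τ r) {Z : Type} (p : Z) (F : V → Z → Z) :
    ∃ φ : V → Z, φ r = p ∧ ∀ v, v ≠ r → φ v = F v (φ (τ (rev (T.par v)))) := by
  classical
  let wf : WellFounded fun v w : V => T.depth v < T.depth w := (measure T.depth).wf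
  let φ : V → Z := wf.fix fun v rec =>
    if h : v = r then p else F v (rec (τ (rev (T.par v))) (T.depth_lt v h))
  have hφ : ∀ v, φ v = if v = r then p else F v (φ (τ (rev (T.par v)))) := by
    intro v
    refine (wf.fix_eq _ v).trans ?_
    split_ifs <;> rfl
  exact ⟨φ, by rw [hφ, if_pos rfl], fun v hv => by rw [hφ, if_neg hv]⟩

end DartTree

/-! ### Tree-cotree decompositions of spheres -/

namespace LabelledSphere

variable {X : Type} (S : LabelledSphere X)

/-- The vertices of the cell decomposition. -/
def Vertex : Type := Quotient (Equiv.Perm.SameCycle.setoid (S.next * S.rev))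

/-- The initial vertex of a dart. -/
def vertexOf (x : S.Dart) : S.Vertex :=
  Quotient.mk (Equiv.Perm.SameCycle.setoid (S.next * S.rev)) x

instance : Finite S.Dart := S.finite

instance : Nonempty S.Dart := S.nonempty

instance : Finite S.Vertex := inferInstanceAs (Finite (Quotient _))

instance : Finite S.Face := inferInstanceAs (Finite (Quotient _))

theorem vertexOf_next (x : S.Dart) : S.vertexOf (S.next x) = S.vertexOf (S.rev x) := by
  refine (Quotient.sound (s := Equiv.Perm.SameCycle.setoid (S.next * S.rev)) ?_).symm
  refine ⟨1, ?_⟩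
  simp [S.rev_rev]

theorem faceOf_next (x : S.Dart) : S.faceOf (S.next x) = S.faceOf x :=
  (Quotient.sound (s := Equiv.Perm.SameCycle.setoid S.next) ⟨1, by simp⟩).symm

theorem vertexOf_surjective : Function.Surjective S.vertexOf := Quotient.mk_surjective

theorem faceOf_surjective : Function.Surjective S.faceOf := Quotient.mk_surjective

/-- A property of darts that is invariant under `rev` and `next` is constant. -/
theorem forall_of_invariant {p : S.Dart → Prop} (hrev : ∀ x, p (S.rev x) ↔ p x)
    (hnext : ∀ x, p (S.next x) ↔ p x) {x : S.Dart} (hx : p x) (y : S.Dart) : p y := by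
  obtain ⟨g, hg, rfl⟩ := S.connected x y
  have key : ∀ z, p (g z) ↔ p z := by
    induction hg using Subgroup.closure_induction with
    | mem g hg =>
      rcases hg with rfl | rfl
      · exact hrev
      · exact hnext
    | one => exact fun z => Iff.rfl
    | mul g h _ _ hg hh => exact fun z => (hg (h z)).trans (hh z)
    | inv g _ hg => exact fun z => by rw [← hg (g⁻¹ z), ← Equiv.Perm.mul_apply, mul_inv_cancel,
        Equiv.Perm.one_apply]
  exact (key x).2 hx

theorem sameCycle_rev_iff (x y : S.Dart) : S.rev.SameCycle x y ↔ y = x ∨ y = S.rev x := by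
  constructor
  · rintro ⟨i, rfl⟩
    have hsq : S.rev ^ (2 : ℤ) = 1 := by
      ext z
      rw [zpow_two, Equiv.Perm.mul_apply, S.rev_rev, Equiv.Perm.one_apply]
    obtain ⟨k, rfl | rfl⟩ := Int.even_or_odd' i
    · left
      rw [zpow_mul, hsq, one_zpow, Equiv.Perm.one_apply]
    · right
      rw [zpow_add, zpow_mul, hsq, one_zpow, one_mul, zpow_one]
  · rintro (rfl | rfl)
    · exact Equiv.Perm.SameCycle.refl _ _
    · exact ⟨1, by simp⟩

/-- There are twice as many darts as edges. -/
theorem card_dart :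
    Nat.card S.Dart = 2 * Nat.card (Quotient (Equiv.Perm.SameCycle.setoid S.rev)) := by
  classical
  have := Fintype.ofFinite S.Dart
  have := Fintype.ofFinite (Quotient (Equiv.Perm.SameCycle.setoid S.rev))
  rw [Nat.card_eq_fintype_card, Nat.card_eq_fintype_card, ← Finset.card_univ,
    Finset.card_eq_sum_card_fiberwise
      (f := Quotient.mk (Equiv.Perm.SameCycle.setoid S.rev)) (t := Finset.univ)
      (fun _ _ => Finset.mem_coe.2 (Finset.mem_univ _)),
    Finset.sum_const_nat (m := 2), mul_comm, Finset.card_univ]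
  intro e _
  induction e using Quotient.inductionOn with
  | h x =>
    have : (Finset.univ.filter fun y =>
        Quotient.mk (Equiv.Perm.SameCycle.setoid S.rev) y = Quotient.mk _ x) = {x, S.rev x} := by
      ext y
      rw [Finset.mem_filter, Finset.mem_insert, Finset.mem_singleton, ← S.sameCycle_rev_iff,
        Equiv.Perm.sameCycle_comm, Quotient.eq]
      exact and_iff_right (Finset.mem_univ _)
    rw [this, Finset.card_pair (S.rev_ne x).symm]

/-- A set of edges that separates the faces into two classes meets every vertex evenly. -/
theorem not_unique_separating (A : Set S.Face) (x : S.Dart)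
    (hx : ¬(S.faceOf x ∈ A ↔ S.faceOf (S.rev x) ∈ A))
    (huniq : ∀ y, ¬(S.faceOf y ∈ A ↔ S.faceOf (S.rev y) ∈ A) → S.vertexOf y = S.vertexOf x →
      y = x) : False := by
  classical
  have := Fintype.ofFinite S.Dart
  let χ : S.Dart → ZMod 2 := fun y => if S.faceOf y ∈ A then 1 else 0
  let D : Finset S.Dart := Finset.univ.filter fun y => S.vertexOf y = S.vertexOf x
  have hinv : ∀ y, S.vertexOf ((S.next * S.rev) y) = S.vertexOf y := fun y => by
    rw [Equiv.Perm.mul_apply, S.vertexOf_next, S.rev_rev]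
  have hface : ∀ y, S.faceOf ((S.next * S.rev) y) = S.faceOf (S.rev y) := fun y => by
    rw [Equiv.Perm.mul_apply, S.faceOf_next]
  -- Turning once around the vertex, the changes of χ between consecutive faces sum to 0. Modulo 2
  -- each separating dart contributes 1, so there cannot be exactly one.
  have hsum : ∑ y ∈ D, χ ((S.next * S.rev) y) = ∑ y ∈ D, χ y :=
    Finset.sum_equiv (S.next * S.rev) (fun y => by
      simp only [D, Finset.mem_filter, Finset.mem_univ, hinv]) (fun _ _ => rfl)
  have hzero : ∑ y ∈ D, (χ ((S.next * S.rev) y) - χ y) = 0 := by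
    rw [Finset.sum_sub_distrib, hsum, sub_self]
  rw [Finset.sum_eq_single x] at hzero
  · simp only [χ, hface] at hzero
    by_cases h1 : S.faceOf x ∈ A <;> by_cases h2 : S.faceOf (S.rev x) ∈ A <;>
      simp [h1, h2] at hx hzero
  · intro y hy hyx
    have h : S.faceOf y ∈ A ↔ S.faceOf (S.rev y) ∈ A := by
      by_contra h
      exact hyx (huniq y h (Finset.mem_filter.1 hy).2)
    simp only [χ, hface, h, sub_self]
  · intro h
    exact absurd (Finset.mem_filter.2 ⟨Finset.mem_univ x, rfl⟩ : x ∈ D) h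

/-- A spanning tree of the vertices and a spanning tree of the faces, with arbitrary roots, such
that every edge is in one of them. -/
theorem exists_tree_cotree (r : S.Vertex) (r' : S.Face) :
    ∃ (T : DartTree S.rev S.vertexOf r) (T' : DartTree S.rev S.faceOf r'),
      ∀ x, x ∈ T.darts ∨ x ∈ T'.darts := by
  have hrevP : ∀ {V : Type} {τ : S.Dart → V} {r : V} (T : DartTree S.rev τ r),
      ∀ x ∈ T.darts, S.rev x ∈ T.darts := by
    rintro V τ r T x ⟨v, hv, rfl | rfl⟩
    · exact ⟨v, hv, Or.inr rfl⟩
    · exact ⟨v, hv, Or.inl (S.rev_rev _)⟩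
  obtain ⟨T, -⟩ := DartTree.exists_subset (τ := S.vertexOf) (r := r) S.rev_rev Set.univ
    (fun _ _ => Set.mem_univ _) (by
      intro A hr hA v
      obtain ⟨x, rfl⟩ := S.vertexOf_surjective r
      obtain ⟨y, rfl⟩ := S.vertexOf_surjective v
      have hiff : ∀ z, S.vertexOf (S.rev z) ∈ A ↔ S.vertexOf z ∈ A := fun z =>
        ⟨fun h => by simpa [S.rev_rev] using hA (S.rev z) (Set.mem_univ _) h,
          hA z (Set.mem_univ _)⟩
      exact S.forall_of_invariant (p := fun z => S.vertexOf z ∈ A) hiff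
        (fun z => by rw [S.vertexOf_next]; exact hiff z) hr y)
  -- The faces are connected across the edges outside T: otherwise the edges separating two classes
  -- of faces all lie in T, and a leaf of this subforest is a vertex with a single separating dart.
  obtain ⟨T', hT'⟩ := DartTree.exists_subset (τ := S.faceOf) (r := r') S.rev_rev T.dartsᶜ
    (fun x hx h => hx (by simpa [S.rev_rev] using hrevP T _ h)) (by
      intro A hr hA f
      by_contra hf
      obtain ⟨x, rfl⟩ := S.faceOf_surjective r'
      obtain ⟨y, rfl⟩ := S.faceOf_surjective f
      let K : Set S.Dart := {z | ¬(S.faceOf z ∈ A ↔ S.faceOf (S.rev z) ∈ A)}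
      have hne : K.Nonempty := by
        by_contra hK
        rw [Set.not_nonempty_iff_eq_empty] at hK
        refine hf (S.forall_of_invariant (p := fun z => S.faceOf z ∈ A) (fun z => ?_)
          (fun z => by rw [S.faceOf_next]) hr y)
        by_contra hz
        have : z ∈ K := fun h => hz h.symm
        rw [hK] at this
        exact this
      have hKT : K ⊆ T.darts := by
        intro z hz
        by_contra hzT
        have hzT' : S.rev z ∈ T.dartsᶜ := fun h =>
          hzT (by simpa [S.rev_rev] using hrevP T _ h)
        exact hz ⟨hA z hzT, fun h => by simpa [S.rev_rev] using hA _ hzT' h⟩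
      obtain ⟨v, -, z, hz, rfl, huniq⟩ := T.exists_leaf S.rev_rev hKT
        (fun z hz h => hz (by rw [S.rev_rev] at h; exact h.symm)) hne
      exact S.not_unique_separating A z hz huniq)
  refine ⟨T, T', ?_⟩
  -- By Euler's formula, T' has as many darts as the complement of T, which contains it, so the two
  -- are equal.
  have h1 := T.card_darts S.rev_rev
  have h2 := T'.card_darts S.rev_rev
  have h3 := Set.ncard_add_ncard_compl T.darts
  have h4 := S.card_dart
  have h5 : Nat.card S.Vertex + Nat.card S.Face = _ := S.euler
  have heq : T'.darts = T.dartsᶜ :=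
    Set.eq_of_subset_of_ncard_le hT' (by omega) (Set.toFinite _)
  intro x
  rw [heq]
  exact Classical.em _

end LabelledSphere

/-! ### Walks and weights in sets with an action -/

section Walk

variable {X Z : Type} (σ : X → Equiv.Perm Z) (wt : X → Z → ℤ)

/-- The permutation by which a letter acts. -/
def letterPerm : X × Bool → Equiv.Perm Z
  | (x, true) => σ x
  | (x, false) => (σ x)⁻¹

/-- The weight of the edge at `z` labelled by a letter, where the edge from `z` to `σ x z` has
the weight `wt x z`. -/
def letterWeight : X × Bool → Z → ℤ
  | (x, true), z => wt x z
  | (x, false), z => -wt x ((σ x)⁻¹ z)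

/-- The end of the walk from `z` along a word. -/
def walk : GWord X → Z → Z
  | [], z => z
  | l :: w, z => walk w (letterPerm σ l z)

/-- The total weight of the walk from `z` along a word. -/
def walkWeight : GWord X → Z → ℤ
  | [], _ => 0
  | l :: w, z => letterWeight σ wt l z + walkWeight w (letterPerm σ l z)

theorem letterPerm_not (l : X × Bool) (z : Z) :
    letterPerm σ (l.1, !l.2) (letterPerm σ l z) = z := by
  rcases l with ⟨x, _ | _⟩ <;> simp [letterPerm]

theorem letterWeight_not (l : X × Bool) (z : Z) :
    letterWeight σ wt (l.1, !l.2) (letterPerm σ l z) = -letterWeight σ wt l z := by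
  rcases l with ⟨x, _ | _⟩ <;> simp [letterPerm, letterWeight]

theorem walk_append (w w' : GWord X) (z : Z) :
    walk σ (w ++ w') z = walk σ w' (walk σ w z) := by
  induction w generalizing z with
  | nil => rfl
  | cons l w ih => exact ih _

theorem walkWeight_append (w w' : GWord X) (z : Z) :
    walkWeight σ wt (w ++ w') z = walkWeight σ wt w z + walkWeight σ wt w' (walk σ w z) := by
  induction w generalizing z with
  | nil => exact (zero_add _).symm
  | cons l w ih =>
    simp only [List.cons_append, walkWeight, walk, ih, add_assoc]

theorem invRev_cons (l : X × Bool) (w : GWord X) :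
    FreeGroup.invRev (l :: w) = FreeGroup.invRev w ++ [(l.1, !l.2)] := by
  simp [FreeGroup.invRev]

theorem walk_invRev (w : GWord X) (z : Z) : walk σ (FreeGroup.invRev w) (walk σ w z) = z := by
  induction w generalizing z with
  | nil => rfl
  | cons l w ih =>
    rw [invRev_cons, walk_append, walk.eq_2 σ z l w, ih]
    exact letterPerm_not σ l z

theorem walkWeight_invRev (w : GWord X) (z : Z) :
    walkWeight σ wt (FreeGroup.invRev w) (walk σ w z) = -walkWeight σ wt w z := by
  induction w generalizing z with
  | nil => rfl
  | cons l w ih =>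
    rw [invRev_cons, walkWeight_append, walk.eq_2 σ z l w, ih, walk_invRev]
    simp only [walkWeight, letterWeight_not]
    ring

end Walk

/-! ### Mapping labelled spheres to action graphs -/

namespace LabelledSphere

variable {X Z : Type} (S : LabelledSphere X) (σ : X → Equiv.Perm Z) (wt : X → Z → ℤ)

/-- The first `n` letters read around a face from a dart on. -/
def readWord (x : S.Dart) (n : ℕ) : GWord X :=
  (List.range n).map fun k => S.label ((S.next ^ k) x)

theorem readWord_succ (x : S.Dart) (n : ℕ) :
    S.readWord x (n + 1) = S.readWord x n ++ [S.label ((S.next ^ n) x)] := by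
  simp [readWord, List.range_succ]

/-- The vertex labelling `φ` is compatible with the action of the label of `x`. -/
def Compatible (φ : S.Vertex → Z) (x : S.Dart) : Prop :=
  letterPerm σ (S.label x) (φ (S.vertexOf x)) = φ (S.vertexOf (S.rev x))

theorem Compatible.rev {φ : S.Vertex → Z} {x : S.Dart} (h : S.Compatible σ φ x) :
    S.Compatible σ φ (S.rev x) := by
  unfold Compatible at h ⊢
  rw [S.label_rev, S.rev_rev, ← h, letterPerm_not]

theorem next_pow_minimalPeriod (x : S.Dart) :
    (S.next ^ Function.minimalPeriod S.next x) x = x := by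
  rw [Equiv.Perm.coe_pow]
  exact Function.isPeriodicPt_minimalPeriod S.next x

theorem next_pow_inj {x : S.Dart} {i j : ℕ} (hi : i < Function.minimalPeriod S.next x)
    (hj : j < Function.minimalPeriod S.next x) (h : (S.next ^ i) x = (S.next ^ j) x) : i = j := by
  rw [Equiv.Perm.coe_pow, Equiv.Perm.coe_pow] at h
  exact Function.iterate_injOn_Iio_minimalPeriod hi hj h

theorem faceOf_next_pow (x : S.Dart) (i : ℕ) : S.faceOf ((S.next ^ i) x) = S.faceOf x := by
  induction i with
  | zero => rfl
  | succ i ih => rw [pow_succ', Equiv.Perm.mul_apply, S.faceOf_next, ih]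

theorem exists_next_pow {x y : S.Dart} (h : S.faceOf y = S.faceOf x) :
    ∃ i, i < Function.minimalPeriod S.next x ∧ (S.next ^ i) x = y := by
  classical
  have := Fintype.ofFinite S.Dart
  have hc : S.next.SameCycle x y := (Quotient.exact h).symm
  obtain ⟨i, -, rfl⟩ := hc.exists_pow_eq'
  refine ⟨i % Function.minimalPeriod S.next x, Nat.mod_lt _ ?_, ?_⟩
  · exact Function.minimalPeriod_pos_of_mem_periodicPts
      (S.next.injective.mem_periodicPts x)
  · rw [Equiv.Perm.coe_pow, Equiv.Perm.coe_pow, Function.iterate_mod_minimalPeriod_eq]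

/-- If the word read around a face fixes the label of its starting vertex, the face does not have
just one incompatible dart. -/
theorem compatible_of_unique (φ : S.Vertex → Z) (x y : S.Dart)
    (hx : walk σ (S.wordFrom x) (φ (S.vertexOf x)) = φ (S.vertexOf x))
    (hy : S.faceOf y = S.faceOf x)
    (h : ∀ y', S.faceOf y' = S.faceOf x → y' ≠ y → S.Compatible σ φ y') :
    S.Compatible σ φ y := by
  obtain ⟨j, hj, rfl⟩ := S.exists_next_pow hy
  set n := Function.minimalPeriod S.next x with hn
  -- `P` follows the boundary word and `z` the vertex labels. They agree from 0 forward up to j, and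
  -- from n, where the word has closed up, backward down to j + 1. The step of `P` at j is then the
  -- compatibility of the remaining dart.
  set P : ℕ → Z := fun i => walk σ (S.readWord x i) (φ (S.vertexOf x)) with hPdef
  set z : ℕ → Z := fun i => φ (S.vertexOf ((S.next ^ i) x)) with hzdef
  have hP : ∀ i, P (i + 1) = letterPerm σ (S.label ((S.next ^ i) x)) (P i) := fun i => by
    simp only [hPdef, readWord_succ, walk_append]
    rfl
  have hz : ∀ i, z (i + 1) = φ (S.vertexOf (S.rev ((S.next ^ i) x))) := fun i => by
    simp only [hzdef, pow_succ', Equiv.Perm.mul_apply, S.vertexOf_next]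
  have hcomp : ∀ i, i < n → i ≠ j → letterPerm σ (S.label ((S.next ^ i) x)) (z i) = z (i + 1) :=
    fun i hi hij => by
      rw [hz]
      exact h _ (S.faceOf_next_pow x i) fun he => hij (S.next_pow_inj hi hj he)
  have hlow : ∀ i, i ≤ j → P i = z i := by
    intro i
    induction i with
    | zero => exact fun _ => rfl
    | succ i ih => exact fun hi => by rw [hP, ih (by omega), hcomp i (by omega) (by omega)]
  have hhigh : ∀ m, m + j + 1 ≤ n → P (n - m) = z (n - m) := by
    intro m
    induction m with
    | zero =>
      intro _
      have hzn : z n = φ (S.vertexOf x) := by simp only [hzdef, hn, S.next_pow_minimalPeriod]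
      rw [Nat.sub_zero, hzn]
      exact hx
    | succ m ih =>
      intro hm
      have h1 := ih (by omega)
      have h2 : n - m = n - (m + 1) + 1 := by omega
      rw [h2, hP, ← hcomp _ (by omega) (by omega)] at h1
      exact (letterPerm σ _).injective h1
  have h1 := hhigh (n - (j + 1)) (by omega)
  have h2 : n - (n - (j + 1)) = j + 1 := by omega
  rw [h2, hP, hlow j le_rfl, hz] at h1
  exact h1

/-- The weight of a dart under a vertex labelling. -/
def dartWeight (φ : S.Vertex → Z) (x : S.Dart) : ℤ :=
  letterWeight σ wt (S.label x) (φ (S.vertexOf x))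

/-- Reversing a dart changes the sign of its weight, so the sum equals its own negative. -/
theorem sum_dartWeight_eq_zero [Fintype S.Dart] {φ : S.Vertex → Z}
    (h : ∀ x, S.Compatible σ φ x) : ∑ x, S.dartWeight σ wt φ x = 0 := by
  have hrev : ∀ x, S.dartWeight σ wt φ (S.rev x) = -S.dartWeight σ wt φ x := fun x => by
    rw [dartWeight, ← show _ = _ from h x, S.label_rev, letterWeight_not, dartWeight]
  have h1 : ∑ x, S.dartWeight σ wt φ (S.rev x) = ∑ x, S.dartWeight σ wt φ x :=
    Equiv.sum_comp S.rev _
  simp only [hrev, Finset.sum_neg_distrib] at h1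
  omega

theorem walk_readWord {φ : S.Vertex → Z} (h : ∀ x, S.Compatible σ φ x) (x : S.Dart) (n : ℕ) :
    walk σ (S.readWord x n) (φ (S.vertexOf x)) = φ (S.vertexOf ((S.next ^ n) x)) := by
  induction n with
  | zero => rfl
  | succ n ih =>
    rw [readWord_succ, walk_append, ih, pow_succ', Equiv.Perm.mul_apply, S.vertexOf_next]
    exact h _

theorem walk_wordFrom {φ : S.Vertex → Z} (h : ∀ x, S.Compatible σ φ x) (x : S.Dart) :
    walk σ (S.wordFrom x) (φ (S.vertexOf x)) = φ (S.vertexOf x) := by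
  have := S.walk_readWord σ h x (Function.minimalPeriod S.next x)
  rwa [S.next_pow_minimalPeriod] at this

/-- The powers of `next` below the minimal period list the darts of the face once each, and by
compatibility the vertex labels follow the walk. -/
theorem sum_face_dartWeight [Fintype S.Dart] [DecidableEq S.Face] {φ : S.Vertex → Z}
    (h : ∀ x, S.Compatible σ φ x) (x : S.Dart) :
    ∑ y with S.faceOf y = S.faceOf x, S.dartWeight σ wt φ y =
      walkWeight σ wt (S.wordFrom x) (φ (S.vertexOf x)) := by
  classical
  have himage : (Finset.univ.filter fun y => S.faceOf y = S.faceOf x) =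
      (Finset.range (Function.minimalPeriod S.next x)).image fun i => (S.next ^ i) x := by
    ext y
    simp only [Finset.mem_filter, Finset.mem_univ, true_and, Finset.mem_image, Finset.mem_range]
    refine ⟨S.exists_next_pow, ?_⟩
    rintro ⟨i, -, rfl⟩
    exact S.faceOf_next_pow x i
  have hsum : ∀ n, ∑ i ∈ Finset.range n, S.dartWeight σ wt φ ((S.next ^ i) x) =
      walkWeight σ wt (S.readWord x n) (φ (S.vertexOf x)) := by
    intro n
    induction n with
    | zero => rfl
    | succ n ih =>
      rw [Finset.sum_range_succ, ih, readWord_succ, walkWeight_append, S.walk_readWord σ h]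
      simp [walkWeight, dartWeight]
  rw [himage, Finset.sum_image, hsum]
  · rfl
  · exact fun i hi j hj => S.next_pow_inj (Finset.mem_range.1 hi) (Finset.mem_range.1 hj)

/-- If around all faces but one the words fix the possible labels of some starting vertex, any
label of one vertex extends to a compatible vertex labelling, provided that it is fixed
by the word read around one further face. -/
theorem exists_compatible (outer inner : S.Face) (x₀ : S.Dart) (hx₀ : S.faceOf x₀ = outer)
    (p : Z) (hp : walk σ (S.wordFrom x₀) p = p)
    (hcell : ∀ f, f ≠ outer → f ≠ inner →
      ∃ x, S.faceOf x = f ∧ ∀ z, walk σ (S.wordFrom x) z = z) :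
    ∃ φ : S.Vertex → Z, φ (S.vertexOf x₀) = p ∧ ∀ x, S.Compatible σ φ x := by
  -- Labels spread from p along T, so only darts of T' can be incompatible. Rooting T' at `inner`
  -- ensures that a leaf of the bad edges is a face other than `inner`, whose word is known to close
  -- up.
  obtain ⟨T, T', hTT'⟩ := S.exists_tree_cotree (S.vertexOf x₀) inner
  obtain ⟨φ, hφ₀, hφ⟩ :=
    T.exists_rec p fun v => letterPerm σ (S.label (S.rev (T.par v)))
  refine ⟨φ, hφ₀, ?_⟩
  have htree : ∀ x ∈ T.darts, S.Compatible σ φ x := by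
    have key : ∀ v, v ≠ S.vertexOf x₀ → S.Compatible σ φ (S.rev (T.par v)) := fun v hv => by
      unfold Compatible
      rw [S.rev_rev, T.tail_par v hv]
      exact (hφ v hv).symm
    rintro x ⟨v, hv, rfl | rfl⟩
    · simpa [S.rev_rev] using (key v hv).rev
    · exact key v hv
  by_contra hbad
  obtain ⟨f, hf, y, hy, rfl, huniq⟩ := T'.exists_leaf S.rev_rev
    (K := {x | ¬S.Compatible σ φ x})
    (fun x hx => (hTT' x).resolve_left fun h => hx (htree x h))
    (fun x hx h => hx (by simpa [S.rev_rev] using h.rev))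
    (not_forall.1 hbad)
  obtain ⟨x, hxy, hx⟩ : ∃ x, S.faceOf x = S.faceOf y ∧
      walk σ (S.wordFrom x) (φ (S.vertexOf x)) = φ (S.vertexOf x) := by
    by_cases ho : S.faceOf y = outer
    · exact ⟨x₀, hx₀.trans ho.symm, by rw [hφ₀, hp]⟩
    · obtain ⟨x, hxy, hx⟩ := hcell _ ho hf
      exact ⟨x, hxy, hx _⟩
  refine hy (S.compatible_of_unique σ φ x y hx hxy.symm fun y' hy' hne => ?_)
  by_contra hc
  exact hne (huniq y' hc (hy'.trans hxy))

end LabelledSphere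

/-- A lower bound for the area of annular diagrams: suppose that the group acts on `Z`, that the
edges of the action graph have integral weights whose sum around every relator is at most
`1` in absolute value, and that `u` labels a closed walk of weight `M` while all closed walks
labelled by `v` have weight `0`. -/
theorem le_annArea {X Z : Type} {R : Set (GWord X)} (σ : X → Equiv.Perm Z) (wt : X → Z → ℤ)
    (hR : ∀ r ∈ R, ∀ z, walk σ r z = z) (hwt : ∀ r ∈ R, ∀ z, |walkWeight σ wt r z| ≤ 1)
    {u v : GWord X} (hu : u ≠ []) (hv : v ≠ []) {p : Z} {M : ℕ} (hup : walk σ u p = p)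
    (huM : walkWeight σ wt u p = M)
    (hv0 : ∀ z, walk σ v z = z → walkWeight σ wt v z = 0) :
    (M : ℕ∞) ≤ annArea R u v := by
  classical
  refine le_iInf fun A => ?_
  cases A with
  | point => exact absurd rfl hu
  | discLeft D => exact absurd rfl hv
  | discRight D => exact absurd rfl hu
  | annulus D =>
    obtain ⟨S, outer, inner, hne, ⟨x₀, hx₀, hwx₀⟩, ⟨x₁, hx₁, hwx₁⟩, hcell⟩ := D
    have hfix : ∀ r ∈ R, ∀ z, walk σ (FreeGroup.invRev r) z = z := fun r hr z => by
      conv_lhs => rw [← hR r hr z]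
      exact walk_invRev σ r z
    obtain ⟨φ, hφ, hcomp⟩ := S.exists_compatible σ outer inner x₀ hx₀ p (by rw [hwx₀, hup])
      (by
        intro f ho hi
        obtain ⟨r, hr, ⟨x, hx, hw⟩ | ⟨x, hx, hw⟩⟩ := hcell f ho hi
        · exact ⟨x, hx, by rw [hw]; exact hR r hr⟩
        · exact ⟨x, hx, by rw [hw]; exact hfix r hr⟩)
    have := Fintype.ofFinite S.Dart
    have := Fintype.ofFinite S.Face
    let W : S.Face → ℤ := fun f => ∑ y with S.faceOf y = f, S.dartWeight σ wt φ y
    have hW : ∀ x, W (S.faceOf x) = walkWeight σ wt (S.wordFrom x) (φ (S.vertexOf x)) :=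
      S.sum_face_dartWeight σ wt hcomp
    have htotal : ∑ f, W f = 0 := by
      rw [← S.sum_dartWeight_eq_zero σ wt hcomp]
      exact Finset.sum_fiberwise _ _ _
    have houter : W outer = M := by rw [← hx₀, hW, hwx₀, hφ, huM]
    have hinner : W inner = 0 := by
      -- Compatibility closes the walk along v⁻¹, hence also the walk along v from the same point,
      -- so `hv0` applies.
      have h1 := S.walk_wordFrom σ hcomp x₁
      rw [hwx₁] at h1
      have h2 := walk_invRev σ (FreeGroup.invRev v) (φ (S.vertexOf x₁))
      rw [h1, FreeGroup.invRev_invRev] at h2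
      have h3 := walkWeight_invRev σ wt v (φ (S.vertexOf x₁))
      rw [h2, hv0 _ h2, neg_zero] at h3
      rw [← hx₁, hW, hwx₁, h3]
    have hlow : ∀ f, f ≠ outer ∧ f ≠ inner → -1 ≤ W f := by
      rintro f ⟨ho, hi⟩
      obtain ⟨r, hr, ⟨x, rfl, hw⟩ | ⟨x, rfl, hw⟩⟩ := hcell f ho hi
      · rw [hW, hw]
        exact (abs_le.1 (hwt r hr _)).1
      · have h1 := walkWeight_invRev σ wt r (φ (S.vertexOf x))
        rw [hR r hr] at h1
        rw [hW, hw, h1]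
        exact neg_le_neg (abs_le.1 (hwt r hr _)).2
    have hnot : (Finset.univ.filter fun f => ¬(f ≠ outer ∧ f ≠ inner)) = {outer, inner} := by
      ext f
      simp only [Finset.mem_filter, Finset.mem_univ, true_and, Finset.mem_insert,
        Finset.mem_singleton]
      tauto
    have hcard : Nat.card {f // f ≠ outer ∧ f ≠ inner} =
        (Finset.univ.filter fun f => f ≠ outer ∧ f ≠ inner).card := by
      rw [Nat.card_eq_fintype_card, Fintype.card_subtype]
    have hsplit : ∑ f with f ≠ outer ∧ f ≠ inner, W f + (M + 0) = 0 := by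
      rw [← houter, ← hinner, ← Finset.sum_pair hne, ← hnot]
      -- The rewriting has turned the 0 on the right into `W inner` as well.
      refine Eq.trans ?_ (htotal.trans hinner.symm)
      exact Finset.sum_filter_add_sum_filter_not Finset.univ _ W
    have hge : _ ≤ ∑ f with f ≠ outer ∧ f ≠ inner, W f :=
      Finset.card_nsmul_le_sum _ W (-1) fun f hf => hlow f (Finset.mem_filter.1 hf).2
    rw [nsmul_eq_mul, ← hcard] at hge
    refine Nat.cast_le.2 (?_ : M ≤ Nat.card {f // f ≠ outer ∧ f ≠ inner})
    omega

/-! ### Conjugacies in `G₄` -/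

section Group

variable {G : Type*} [Group G] {a b c d s : G}

theorem semiconjBy_pow_of_heisenberg (hab : SemiconjBy a b (c * b)) (hac : Commute a c) (k : ℕ) :
    SemiconjBy (a ^ k) b (c ^ k * b) := by
  induction k with
  | zero => simp
  | succ k ih =>
    have h := SemiconjBy.mul_left (SemiconjBy.mul_right (hac.pow_right k) hab) ih
    rwa [← pow_succ', ← mul_assoc, ← pow_succ] at h

theorem semiconjBy_pow_of_doubling (has : SemiconjBy a s (s ^ 2)) (k : ℕ) :
    SemiconjBy (a ^ k) s (s ^ 2 ^ k) := by
  induction k with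
  | zero => simp
  | succ k ih =>
    have h := SemiconjBy.mul_left (has.pow_right (2 ^ k)) ih
    rwa [← pow_succ', ← pow_mul, ← pow_succ'] at h

/-- Both sides are conjugate to b⁻¹s^(2^k). Conjugation by a^k sends b⁻¹ to b⁻¹c^(-k), which cancels
c^k, while d^k commutes with b; both raise s to the power 2^k. -/
theorem isConj_of_doubling (hab : SemiconjBy a b (c * b)) (hac : Commute a c)
    (hbd : Commute b d) (has : SemiconjBy a s (s ^ 2)) (hds : SemiconjBy d s (s ^ 2)) (k : ℕ) :
    IsConj (b⁻¹ * c ^ k * s) (b⁻¹ * s) := by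
  have h1 : SemiconjBy (a ^ k) (b⁻¹ * c ^ k * s) (b⁻¹ * s ^ 2 ^ k) := by
    have h := ((semiconjBy_pow_of_heisenberg hab hac k).inv_right.mul_right
      (hac.pow_pow k k)).mul_right (semiconjBy_pow_of_doubling has k)
    rwa [mul_inv_rev, inv_mul_cancel_right] at h
  have h2 : SemiconjBy (d ^ k) (b⁻¹ * s) (b⁻¹ * s ^ 2 ^ k) :=
    SemiconjBy.mul_right (hbd.symm.pow_left k).inv_right (semiconjBy_pow_of_doubling hds k)
  exact (isConj_iff.2 ⟨_, mul_inv_eq_iff_eq_mul.2 h1.eq⟩).trans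
    (isConj_iff.2 ⟨_, mul_inv_eq_iff_eq_mul.2 h2.eq⟩).symm

/-- This expresses c^(n²) by a word of length 4n. -/
theorem commutator_pow_of_heisenberg (hab : SemiconjBy a b (c * b)) (hac : Commute a c)
    (hbc : Commute b c) (n : ℕ) : a ^ n * b ^ n * a⁻¹ ^ n * b⁻¹ ^ n = c ^ n ^ 2 := by
  have h := ((semiconjBy_pow_of_heisenberg hab hac n).pow_right n).eq
  rw [(hbc.symm.pow_left n).mul_pow, ← pow_mul, ← sq] at h
  rw [h, inv_pow, inv_pow, mul_inv_cancel_right, mul_inv_cancel_right]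

end Group

/-! ### Evaluation of words and conjugacy of the witnesses -/

theorem evalWord_append {X : Type} (R : Set (GWord X)) (w w' : GWord X) :
    evalWord R (w ++ w') = evalWord R w * evalWord R w' := by
  rw [evalWord, ← FreeGroup.mul_mk, map_mul]
  rfl

theorem evalWord_replicate {X : Type} (R : Set (GWord X)) (l : X × Bool) (n : ℕ) :
    evalWord R (List.replicate n l) = evalWord R [l] ^ n := by
  induction n with
  | zero =>
    rw [pow_zero, List.replicate_zero, evalWord, ← FreeGroup.one_eq_mk, map_one]
  | succ n ih => rw [List.replicate_succ', evalWord_append, ih, pow_succ]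

theorem evalWord_of_mem {X : Type} {R : Set (GWord X)} {r : GWord X} (hr : r ∈ R) :
    evalWord R r = 1 :=
  PresentedGroup.one_of_mem (Set.mem_image_of_mem _ hr)

namespace GenG4

/-- The generator of `G₄`. -/
def elt (x : GenG4) : GroupOf relators := evalWord relators x.pos

theorem evalWord_pos (x : GenG4) : evalWord relators x.pos = elt x := rfl

theorem evalWord_neg (x : GenG4) : evalWord relators x.neg = (elt x)⁻¹ := by
  rw [elt, evalWord, evalWord, ← map_inv, FreeGroup.inv_mk]
  rfl

theorem evalWord_replicate_pos (n : ℕ) (x : GenG4) :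
    evalWord relators (List.replicate n (x, true)) = elt x ^ n := by
  rw [evalWord_replicate]
  rfl

theorem evalWord_replicate_neg (n : ℕ) (x : GenG4) :
    evalWord relators (List.replicate n (x, false)) = (elt x)⁻¹ ^ n := by
  rw [evalWord_replicate, ← evalWord_neg]
  rfl

theorem forall_mem_relators {p : GWord GenG4 → Prop} : (∀ r ∈ relators, p r) ↔
    p (a.pos ++ b.pos ++ a.neg ++ b.neg ++ c.neg) ∧ p (a.pos ++ c.pos ++ a.neg ++ c.neg) ∧
    p (b.pos ++ c.pos ++ b.neg ++ c.neg) ∧ p (b.pos ++ d.pos ++ b.neg ++ d.neg) ∧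
    p (a.pos ++ s.pos ++ a.neg ++ s.neg ++ s.neg) ∧
    p (d.pos ++ s.pos ++ d.neg ++ s.neg ++ s.neg) := by
  simp only [relators, Set.forall_mem_insert, Set.mem_singleton_iff, forall_eq]

theorem elt_relations : SemiconjBy (elt a) (elt b) (elt c * elt b) ∧ Commute (elt a) (elt c) ∧
    Commute (elt b) (elt c) ∧ Commute (elt b) (elt d) ∧ SemiconjBy (elt a) (elt s) (elt s ^ 2) ∧
    SemiconjBy (elt d) (elt s) (elt s ^ 2) := by
  have h : ∀ r ∈ relators, evalWord relators r = 1 := fun r hr => evalWord_of_mem hr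
  simp only [forall_mem_relators, evalWord_append, evalWord_pos, evalWord_neg] at h
  obtain ⟨h1, h2, h3, h4, h5, h6⟩ := h
  simp only [mul_inv_eq_iff_eq_mul] at h1 h2 h3 h4 h5 h6
  simp only [SemiconjBy, commute_iff_eq, sq]
  exact ⟨h1, h2, h3, h4, h5, h6⟩

theorem conjWords_witness (n : ℕ) : ConjWords relators (witnessU n) witnessV := by
  obtain ⟨hab, hac, -, hbd, has, hds⟩ := elt_relations
  have h := isConj_of_doubling hab hac hbd has hds (n ^ 2)
  simpa only [ConjWords, witnessU, witnessV, evalWord_append, evalWord_replicate_pos, evalWord_neg,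
    evalWord_pos] using h

/-- The word `b⁻¹ [aⁿ, bⁿ] s`. -/
def shortWitness (n : ℕ) : GWord GenG4 :=
  b.neg ++ (List.replicate n (a, true) ++ List.replicate n (b, true) ++
    List.replicate n (a, false) ++ List.replicate n (b, false)) ++ s.pos

theorem conjWords_shortWitness (n : ℕ) : ConjWords relators (shortWitness n) witnessV := by
  obtain ⟨hab, hac, hbc, -⟩ := elt_relations
  have h1 : evalWord relators (shortWitness n) = evalWord relators (witnessU n) := by
    simp only [shortWitness, witnessU, evalWord_append, evalWord_replicate_pos,
      evalWord_replicate_neg, commutator_pow_of_heisenberg hab hac hbc n]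
  rw [ConjWords, h1]
  exact conjWords_witness n

/-! ### A permutation representation of `G₄` -/

/-- The permutation `… ↦ -2 ↦ -1 ↦ 1 ↦ 2 ↦ …` of the integers that fixes `0`. -/
def skip : Equiv.Perm ℤ where
  toFun x := if x = 0 then 0 else if x = -1 then 1 else x + 1
  invFun x := if x = 0 then 0 else if x = 1 then -1 else x - 1
  left_inv x := by grind
  right_inv x := by grind

theorem skip_apply (x : ℤ) : skip x = if x = 0 then 0 else if x = -1 then 1 else x + 1 := rfl

theorem skip_eq_zero_iff (x : ℤ) : skip x = 0 ↔ x = 0 := by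
  rw [skip_apply]
  grind

/-- The permutations of `ℤ × ℚ` by which the generators of `G₄` act: on the lines `x = const`,
`b` is the translation by `x`, `c` is the translation by `1`, and `d` maps lines to lines so as
to commute with `b`. -/
def perm : GenG4 → Equiv.Perm (ℤ × ℚ)
  | a => (Equiv.addRight 1).prodCongr (Equiv.refl ℚ)
  | b => Equiv.prodShear (Equiv.refl ℤ) fun x => Equiv.addRight (x : ℚ)
  | c => (Equiv.refl ℤ).prodCongr (Equiv.addRight 1)
  | d => Equiv.prodShear skip fun x =>
      if h : x = 0 then Equiv.refl ℚ else
        Equiv.mulRight₀ ((skip x : ℚ) / x) (div_ne_zero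
          (Int.cast_ne_zero.2 ((skip_eq_zero_iff x).not.2 h)) (Int.cast_ne_zero.2 h))
  | s => 1

theorem perm_a (x : ℤ) (y : ℚ) : perm a (x, y) = (x + 1, y) := rfl

theorem perm_b (x : ℤ) (y : ℚ) : perm b (x, y) = (x, y + x) := rfl

theorem perm_c (x : ℤ) (y : ℚ) : perm c (x, y) = (x, y + 1) := rfl

theorem perm_s : perm s = 1 := rfl

/-- Scaling by `skip x / x` turns the translation by x into the translation by `skip x`; this is why
the second coordinate is rational. The line x = 0 consists of the fixed points of b, so d must
preserve it, hence the jump in `skip`. -/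
theorem perm_d_b (z : ℤ × ℚ) : perm d (perm b z) = perm b (perm d z) := by
  obtain ⟨x, y⟩ := z
  by_cases h : x = 0
  · subst h
    simp [perm, skip_apply, Equiv.prodShear]
  · have hx : (x : ℚ) ≠ 0 := Int.cast_ne_zero.2 h
    simp only [perm, Equiv.prodShear, Equiv.coe_fn_mk, h, dite_false, Equiv.refl_apply,
      Equiv.coe_addRight, Equiv.mulRight₀_apply]
    rw [add_mul, mul_div_cancel₀ _ hx]

theorem perm_b_inv (x : ℤ) (y : ℚ) : (perm b)⁻¹ (x, y) = (x, y - x) := by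
  rw [Equiv.Perm.inv_eq_iff_eq, perm_b, sub_add_cancel]

theorem perm_a_inv (x : ℤ) (y : ℚ) : (perm a)⁻¹ (x, y) = (x - 1, y) := by
  rw [Equiv.Perm.inv_eq_iff_eq, perm_a, sub_add_cancel]

theorem walk_relator : ∀ r ∈ relators, ∀ z, walk perm r z = z := by
  simp only [forall_mem_relators, pos, neg, List.cons_append, List.nil_append, walk, letterPerm,
    Equiv.Perm.inv_eq_iff_eq, perm_s, Equiv.Perm.one_apply, implies_true, and_true]
  refine ⟨?_, ?_, ?_, perm_d_b⟩ <;> rintro ⟨x, y⟩ <;> simp only [perm_a, perm_b, perm_c] <;>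
    push_cast <;> ring_nf

/-- The weights of the edges of the action graph: the edges labelled `s` on the line `x = m` have
the weight `2 ^ (m - 1)` if `m ≥ 1`, and all other edges have the weight `0`. -/
def weight : GenG4 → ℤ × ℚ → ℤ
  | s, z => if 1 ≤ z.1 then 2 ^ (z.1 - 1).toNat else 0
  | _, _ => 0

theorem weight_s (z : ℤ × ℚ) : weight s z = if 1 ≤ z.1 then 2 ^ (z.1 - 1).toNat else 0 := rfl

theorem weight_of_ne {x : GenG4} (h : x ≠ s) (z : ℤ × ℚ) : weight x z = 0 := by
  cases x <;> first | rfl | exact absurd rfl h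

theorem letterWeight_of_ne {x : GenG4} (h : x ≠ s) (e : Bool) (z : ℤ × ℚ) :
    letterWeight perm weight (x, e) z = 0 := by
  cases e <;> simp [letterWeight, weight_of_ne h]

theorem walkWeight_of_ne (w : GWord GenG4) (h : ∀ l ∈ w, l.1 ≠ s) (z : ℤ × ℚ) :
    walkWeight perm weight w z = 0 := by
  induction w generalizing z with
  | nil => rfl
  | cons l w ih =>
    rw [walkWeight, letterWeight_of_ne (h l List.mem_cons_self), zero_add]
    exact ih (fun l' hl' => h l' (List.mem_cons_of_mem _ hl')) _

/-- The weight of an edge labelled `s` doubles along the edges labelled `a` and `d`, up to `1`. -/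
theorem abs_weight_sub_le (z z' : ℤ × ℚ) (h : z'.1 = z.1 + 1 ∨ z'.1 = skip z.1) :
    |weight s z' - 2 * weight s z| ≤ 1 := by
  rw [skip_apply] at h
  rw [weight_s, weight_s]
  by_cases h1 : 1 ≤ z.1
  · have h2 : z'.1 = z.1 + 1 := by grind
    have h3 : (z'.1 - 1).toNat = (z.1 - 1).toNat + 1 := by omega
    rw [if_pos h1, if_pos (by omega), h3, pow_succ']
    simp
  · rw [if_neg h1]
    -- From x ≤ 0, both maps can enter the positive lines only at x = 1, where the weight is 1: this
    -- is the only defect of doubling.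
    by_cases h2 : 1 ≤ z'.1
    · have h3 : (z'.1 - 1).toNat = 0 := by grind
      simp [h2, h3]
    · simp [h2]

/-- Only the last two relators contain `s`. Their weight at z is that of the loop at the image of z
under `a` or `d`, minus twice that of the loop at z. -/
theorem abs_walkWeight_relator_le :
    ∀ r ∈ relators, ∀ z, |walkWeight perm weight r z| ≤ 1 := by
  have key : ∀ x, x ≠ s → (∀ z, (perm x z).1 = z.1 + 1 ∨ (perm x z).1 = skip z.1) → ∀ z,
      |walkWeight perm weight (x.pos ++ s.pos ++ x.neg ++ s.neg ++ s.neg) z| ≤ 1 := by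
    intro x hx hstep z
    have h := abs_weight_sub_le z (perm x z) (hstep z)
    have hs : ∀ z, letterWeight perm weight (s, true) z = weight s z := fun _ => rfl
    have hs' : ∀ z, letterWeight perm weight (s, false) z = -weight s z := fun _ => rfl
    have hinv : (perm x)⁻¹ (perm x z) = z := (perm x).symm_apply_apply z
    simp only [pos, neg, List.cons_append, List.nil_append, walkWeight, letterWeight_of_ne hx,
      letterPerm, perm_s, inv_one, Equiv.Perm.one_apply, hinv, hs, hs']
    convert h using 2
    ring
  rw [forall_mem_relators]
  refine ⟨fun z => ?_, fun z => ?_, fun z => ?_, fun z => ?_, key a (by simp) fun z => Or.inl rfl,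
    key d (by simp) fun z => Or.inr rfl⟩ <;>
  · rw [walkWeight_of_ne _ (by simp [pos, neg])]
    simp

/-! ### Closed walks of the witness words -/

theorem walk_replicate_a (n : ℕ) (x : ℤ) (y : ℚ) :
    walk perm (List.replicate n (a, true)) (x, y) = (x + n, y) := by
  induction n generalizing x with
  | zero => simp [walk]
  | succ n ih =>
    rw [List.replicate_succ, walk, letterPerm, perm_a, ih]
    push_cast
    ring_nf

theorem walk_replicate_a_inv (n : ℕ) (x : ℤ) (y : ℚ) :
    walk perm (List.replicate n (a, false)) (x, y) = (x - n, y) := by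
  induction n generalizing x with
  | zero => simp [walk]
  | succ n ih =>
    rw [List.replicate_succ, walk, letterPerm, perm_a_inv, ih]
    push_cast
    ring_nf

theorem walk_replicate_b (n : ℕ) (x : ℤ) (y : ℚ) :
    walk perm (List.replicate n (b, true)) (x, y) = (x, y + n * x) := by
  induction n generalizing y with
  | zero => simp [walk]
  | succ n ih =>
    rw [List.replicate_succ, walk, letterPerm, perm_b, ih]
    push_cast
    ring_nf

theorem walk_replicate_b_inv (n : ℕ) (x : ℤ) (y : ℚ) :
    walk perm (List.replicate n (b, false)) (x, y) = (x, y - n * x) := by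
  induction n generalizing y with
  | zero => simp [walk]
  | succ n ih =>
    rw [List.replicate_succ, walk, letterPerm, perm_b_inv, ih]
    push_cast
    ring_nf

theorem walk_replicate_c (n : ℕ) (x : ℤ) (y : ℚ) :
    walk perm (List.replicate n (c, true)) (x, y) = (x, y + n) := by
  induction n generalizing y with
  | zero => simp [walk]
  | succ n ih =>
    rw [List.replicate_succ, walk, letterPerm, perm_c, ih]
    push_cast
    ring_nf

/-- Let `w` be a word without `s` that acts on the line `x = k` as `c ^ k`. Then annular diagrams
for `b⁻¹ w s` and `b⁻¹ s` have at least `2 ^ (k - 1)` faces. -/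
theorem two_pow_le_annArea {w : GWord GenG4} (hw : ∀ l ∈ w, l.1 ≠ s) {k : ℕ} (hk : 1 ≤ k)
    (hwk : ∀ y, walk perm w ((k : ℤ), y) = ((k : ℤ), y + k)) :
    2 ^ (k - 1) ≤ annArea relators (b.neg ++ w ++ s.pos) witnessV := by
  have h1 : ∀ z, walkWeight perm weight b.neg z = 0 := walkWeight_of_ne _ (by simp [neg])
  have h2 : ∀ z, walk perm b.neg z = (z.1, z.2 - z.1) := fun z => perm_b_inv z.1 z.2
  have h3 : ∀ z, walkWeight perm weight s.pos z = weight s z := fun z => add_zero _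
  have h4 : ∀ z, walk perm s.pos z = z := fun z => rfl
  -- From (k, 0), b⁻¹ leads to (k, -k) and w leads back; the loop `s` there has weight 2^(k-1).
  have h := le_annArea (R := relators) perm weight walk_relator abs_walkWeight_relator_le
    (u := b.neg ++ w ++ s.pos) (v := witnessV) (p := ((k : ℤ), 0)) (M := 2 ^ (k - 1))
    (by simp [neg]) (by simp [witnessV, neg])
    (by simp [walk_append, h2, h4, hwk])
    (by
      have hk' : ((k : ℤ) - 1).toNat = k - 1 := by omega
      have hk'' : (1 : ℤ) ≤ k := by omega
      simp [walkWeight_append, h1, h2, h3, hwk, walkWeight_of_ne w hw, weight_s, hk',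
        hk''])
    (by
      rintro ⟨x, y⟩ hz
      rw [witnessV, walk_append, h2, h4, Prod.mk.injEq] at hz
      -- As `s` acts trivially, v closes up only where b⁻¹ has fixed points.
      have hx : x = 0 := by simpa using hz.2
      subst hx
      rw [witnessV, walkWeight_append, h1, h2, h3, weight_s]
      simp)
  exact_mod_cast h

theorem two_pow_le_annArea_witness {n : ℕ} (hn : 1 ≤ n) :
    2 ^ (n ^ 2 - 1) ≤ annArea relators (witnessU n) witnessV :=
  two_pow_le_annArea (fun l hl => by simp [List.eq_of_mem_replicate hl]) (Nat.one_le_pow _ _ hn)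
    fun y => by rw [walk_replicate_c]

theorem two_pow_le_annArea_shortWitness {n : ℕ} (hn : 1 ≤ n) :
    2 ^ (n ^ 2 - 1) ≤ annArea relators (shortWitness n) witnessV := by
  refine two_pow_le_annArea (k := n ^ 2) ?_ (Nat.one_le_pow _ _ hn) fun y => ?_
  · simp only [List.mem_append]
    rintro l (((hl | hl) | hl) | hl) <;> simp [List.eq_of_mem_replicate hl]
  -- The power bⁿ is applied on the line x + n and undone on the line x, which leaves the
  -- translation by n(x + n) - nx = n².
  · simp only [walk_append, walk_replicate_a, walk_replicate_b, walk_replicate_a_inv,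
      walk_replicate_b_inv]
    push_cast
    ring_nf

/-- The bound 4n + 4 is the total length: 4n + 2 for `shortWitness n` and 2 for `witnessV`. -/
theorem two_pow_le_annularDehn {n m : ℕ} (hn : 1 ≤ n) (hm : 4 * n + 4 ≤ m) :
    2 ^ (n ^ 2 - 1) ≤ annularDehn relators m := by
  refine (two_pow_le_annArea_shortWitness hn).trans ?_
  refine le_iSup_of_le (shortWitness n) (le_iSup_of_le witnessV ?_)
  refine le_iSup_of_le ?_ (le_iSup_of_le (conjWords_shortWitness n) le_rfl)
  simp only [shortWitness, witnessV, pos, neg, List.length_append, List.length_replicate,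
    List.length_cons, List.length_nil]
  omega

end GenG4

theorem mainTheorem5 :
    AsympLE (fun n => 2 ^ (n ^ 2)) (annularDehn GenG4.relators) ∧
      ∀ n : ℕ, 1 ≤ n →
        ConjWords GenG4.relators (GenG4.witnessU n) GenG4.witnessV ∧
        2 ^ (n ^ 2 - 1) ≤ annArea GenG4.relators (GenG4.witnessU n) GenG4.witnessV := by
  -- With C = 8, the argument 9n is at least 4n + 4 for n ≥ 1, and the factor C absorbs the 2 lost
  -- in the exponent n² - 1. For n = 0 the additive constant suffices.
  refine ⟨⟨8, by norm_num, fun n => ?_⟩, fun n hn =>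
    ⟨GenG4.conjWords_witness n, GenG4.two_pow_le_annArea_witness hn⟩⟩
  rcases Nat.eq_zero_or_pos n with rfl | hn
  · refine le_add_left ?_
    norm_num
  · have h := GenG4.two_pow_le_annularDehn (m := 8 * n + n) hn (by omega)
    have hsq : n ^ 2 = n ^ 2 - 1 + 1 := by
      have := Nat.one_le_pow 2 n hn
      omega
    rw [add_assoc]
    refine le_add_right ?_
    calc (2 : ℕ∞) ^ n ^ 2 = 2 * 2 ^ (n ^ 2 - 1) := by rw [hsq, pow_succ', Nat.add_sub_cancel]
      _ ≤ (8 : ℕ) * annularDehn GenG4.relators (8 * n + n) :=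
        mul_le_mul' (by norm_num) h
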